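/- Let $\mathcal{W}$ be a von Neumann algebra with its weak-$*$ topology, and let $\mathcal{A}\subset\mathcal{B}\subset\mathcal{W}$ be subalgebras containing the unit of $\mathcal{W}$ (not necessarily self-adjoint or norm-closed). For $\mathcal{X}\in\{\mathcal{A},\mathcal{B}\}$ let $\operatorname{AC}_{\mathcal{W}}(\mathcal{X})\subset\mathcal{X}^*$ be the subspace of those functionals that extend to a weak-$*$ continuous linear functional on $\mathcal{W}$. We say that $\mathcal{X}$ admits a Lebesgue decomposition (relative to $\mathcal{W}$) if there is a bounded linear idempotent $L:\mathcal{X}^*\to\mathcal{X}^*$ with $L\mathcal{X}^*=\operatorname{AC}_{\mathcal{W}}(\mathcal{X})$ and $\|\varphi\|=\|L\varphi\|+\|(I-L)\varphi\|$ for all $\varphi\in\mathcal{X}^*$; such an $L$ is unique, and we put $\operatorname{SG}_{\mathcal{W}}(\mathcal{X})=(I-L)\mathcal{X}^*$. For $\varphi\in\mathcal{X}^*$, $a\in\mathcal{X}$ and $\Lambda,\Xi\in\mathcal{X}^{**}$ define $\varphi a\in\mathcal{X}^*$ by $(\varphi a)(b)=\varphi(ab)$, $\Lambda\varphi\in\mathcal{X}^*$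 by $(\Lambda\varphi)(a)=\Lambda(\varphi a)$, and the Arens product $\Lambda\Xi\in\mathcal{X}^{**}$ by $(\Lambda\Xi)(\varphi)=\Lambda(\Xi\varphi)$. A Lebesgue projection of $\mathcal{X}$ is a central projection $\mathfrak{z}\in\mathcal{X}^{**}$ (that is, an element with $\mathfrak{z}^2=\mathfrak{z}$ and $\|\mathfrak{z}\|\le 1$ that commutes with every element of $\mathcal{X}^{**}$) such that $\operatorname{AC}_{\mathcal{W}}(\mathcal{X})=\mathfrak{z}\mathcal{X}^*$. Suppose that both $\mathcal{A}$ and $\mathcal{B}$ admit Lebesgue decompositions. Then $\mathcal{A}$ has a unique Lebesgue projection $\mathfrak{z}_{\mathcal{A}}\in\mathcal{A}^{**}$, $\mathcal{B}$ has a unique Lebesgue projection $\mathfrak{z}_{\mathcal{B}}\in\mathcal{B}^{**}$, and the following statements are equivalent. (i) The inclusion $\mathcal{A}\subset\mathcal{B}$ has the Gleason--Whitney property relative to $\mathcal{W}$: whenever $\varphi\in\operatorname{AC}_{\mathcal{W}}(\mathcal{A})$ and $\psi\in\mathcal{B}^*$ satisfies $\psi|_{\mathcal{A}}=\varphi$ and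 $\|\psi\|=\|\varphi\|$, then $\psi\in\operatorname{AC}_{\mathcal{W}}(\mathcal{B})$. (ii) $\mathfrak{z}_{\mathcal{A}}=\mathfrak{z}_{\mathcal{B}}$, where $\Lambda\in\mathcal{A}^{**}$ is identified with the element $\psi\mapsto\Lambda(\psi|_{\mathcal{A}})$ of $\mathcal{B}^{**}$. (iii) The Lebesgue decompositions of $\mathcal{A}$ and $\mathcal{B}$ are compatible: whenever $\psi=\psi_a+\psi_s$ with $\psi_a\in\operatorname{AC}_{\mathcal{W}}(\mathcal{B})$ and $\psi_s\in\operatorname{SG}_{\mathcal{W}}(\mathcal{B})$, then $\psi_a|_{\mathcal{A}}\in\operatorname{AC}_{\mathcal{W}}(\mathcal{A})$ and $\psi_s|_{\mathcal{A}}\in\operatorname{SG}_{\mathcal{W}}(\mathcal{A})$. -/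

import Mathlib

/-!
# Lebesgue decompositions and the Gleason-Whitney property

A von Neumann algebra is given abstractly (Sakai): a C*-algebra `W` together with a Banach space
`P` and an isometric isomorphism `e` of `W` onto the dual of `P`. The unital operator algebras are
the subalgebras of `W` that contain the unit of `W`; they need be neither self-adjoint nor closed.
-/

noncomputable section

namespace GleasonWhitney

/-! ### The bidual of a unital normed algebra: module action and Arens product -/

section Arens

/-- The space of bounded linear functionals on `A`, with the operator norm. -/
abbrev Dual (A : Type*) [NormedRing A] [NormedAlgebra ℂ A] := StrongDual ℂ A

/-- The bidual of `A`. -/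
abbrev Bidual (A : Type*) [NormedRing A] [NormedAlgebra ℂ A] := StrongDual ℂ (Dual A)

variable {A : Type*} [NormedRing A] [NormedAlgebra ℂ A]

/-- The functional `φ a`, that is `b ↦ φ (a b)`. -/
def rightMul (φ : Dual A) (a : A) : Dual A :=
  φ.comp (ContinuousLinearMap.mul ℂ A a)

/-- The map `φ ↦ (a ↦ φ a)`, as a bounded linear map from `A*` to the bounded maps `A → A*`. -/
def rightMulL (A : Type*) [NormedRing A] [NormedAlgebra ℂ A] :
    Dual A →L[ℂ] A →L[ℂ] Dual A :=
  ((ContinuousLinearMap.compL ℂ A (A →L[ℂ] A) (Dual A)).flip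
    (ContinuousLinearMap.mul ℂ A)).comp (ContinuousLinearMap.compL ℂ A A ℂ)

theorem rightMulL_apply (φ : Dual A) (a : A) : rightMulL A φ a = rightMul φ a := rfl

/-- The left module action of the bidual on the dual: `(Λ φ) a = Λ (φ a)`. -/
def act (Λ : Bidual A) : Dual A →L[ℂ] Dual A :=
  (ContinuousLinearMap.compL ℂ A (Dual A) ℂ Λ).comp (rightMulL A)

theorem act_apply (Λ : Bidual A) (φ : Dual A) (a : A) :
    act Λ φ a = Λ (rightMul φ a) := rfl

/-- The Arens product of the bidual: `(Λ Ξ) φ = Λ (Ξ φ)`. -/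
def arens (Λ Ξ : Bidual A) : Bidual A :=
  Λ.comp (act Ξ)

theorem arens_apply (Λ Ξ : Bidual A) (φ : Dual A) :
    arens Λ Ξ φ = Λ (act Ξ φ) := rfl

/-- Central projections of the bidual. In an operator algebra, the orthogonal projections are
exactly the idempotents of norm at most one, in every isometric representation on a Hilbert
space. -/
structure IsCentralProjection (z : Bidual A) : Prop where
  idem : arens z z = z
  norm_le_one : ‖z‖ ≤ 1
  central : ∀ Λ : Bidual A, arens z Λ = arens Λ z

end Arens

/-! ### Absolutely continuous functionals and Lebesgue decompositions -/

section Lebesgue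

variable {W : Type*} [CStarAlgebra W] {P : Type*} [NormedAddCommGroup P] [NormedSpace ℂ P]

/-- A linear functional on `W` is weak-* continuous if it is continuous for the weak-* topology
that `W` has as the dual space of `P`. -/
def IsWeakStarContinuous (e : W ≃ₗᵢ[ℂ] StrongDual ℂ P) (Φ : W →ₗ[ℂ] ℂ) : Prop :=
  Continuous fun x : WeakDual ℂ P => Φ (e.symm (WeakDual.toStrongDual x))

/-- The subspace of `A*` of the functionals that are absolutely continuous relative to `W`: those
that extend to a weak-* continuous linear functional on `W`. -/
def AC (e : W ≃ₗᵢ[ℂ] StrongDual ℂ P) (A : Subalgebra ℂ W) : Submodule ℂ (Dual A) where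
  carrier := {φ | ∃ Φ : W →ₗ[ℂ] ℂ, IsWeakStarContinuous e Φ ∧ ∀ a : A, Φ (a : W) = φ a}
  zero_mem' := ⟨0, continuous_const, fun _ => rfl⟩
  add_mem' := by
    rintro φ ψ ⟨Φ, hΦ, hφ⟩ ⟨Ψ, hΨ, hψ⟩
    exact ⟨Φ + Ψ, Continuous.add hΦ hΨ, fun a => by simp [hφ a, hψ a]⟩
  smul_mem' := by
    rintro c φ ⟨Φ, hΦ, hφ⟩
    exact ⟨c • Φ, Continuous.const_smul hΦ c, fun a => by simp [hφ a]⟩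

/-- `L` is a bounded linear idempotent on `A*` with range `AC e A` and with
`‖φ‖ = ‖L φ‖ + ‖φ - L φ‖` for all `φ`. Such an `L` is unique if it exists; the associated
Lebesgue decomposition is `φ = L φ + (φ - L φ)`. -/
structure IsLebesgueIdempotent (e : W ≃ₗᵢ[ℂ] StrongDual ℂ P) (A : Subalgebra ℂ W)
    (L : Dual A →L[ℂ] Dual A) : Prop where
  idem : ∀ φ : Dual A, L (L φ) = L φ
  norm_eq : ∀ φ : Dual A, ‖φ‖ = ‖L φ‖ + ‖φ - L φ‖
  range_eq : LinearMap.range (L : Dual A →ₗ[ℂ] Dual A) = AC e A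

/-- `A` admits a Lebesgue decomposition relative to `W`. -/
def AdmitsLebesgueDecomposition (e : W ≃ₗᵢ[ℂ] StrongDual ℂ P) (A : Subalgebra ℂ W) : Prop :=
  ∃ L : Dual A →L[ℂ] Dual A, IsLebesgueIdempotent e A L

/-- The functionals that are singular relative to `W`: the range of `1 - L`, equivalently the
kernel of `L`, where `L` is the idempotent of the Lebesgue decomposition. -/
def SG (e : W ≃ₗᵢ[ℂ] StrongDual ℂ P) (A : Subalgebra ℂ W) : Set (Dual A) :=
  {φ | ∃ L : Dual A →L[ℂ] Dual A, IsLebesgueIdempotent e A L ∧ L φ = 0}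

/-- `z ∈ A**` is a Lebesgue projection of `A` relative to `W`: it is a central projection and
`AC e A = z A*`. -/
structure IsLebesgueProjection (e : W ≃ₗᵢ[ℂ] StrongDual ℂ P) (A : Subalgebra ℂ W)
    (z : Bidual A) : Prop where
  isCentralProjection : IsCentralProjection z
  range_eq : LinearMap.range (act z : Dual A →ₗ[ℂ] Dual A) = AC e A

/-! ### Inclusions -/

/-- The inclusion of `A` in `B`, as a linear isometry. -/
def incl {A B : Subalgebra ℂ W} (h : A ≤ B) : A →ₗᵢ[ℂ] B where
  toLinearMap := (Subalgebra.inclusion h).toLinearMap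
  norm_map' _ := rfl

/-- Restriction of functionals from `B` to `A`. -/
def restrict {A B : Subalgebra ℂ W} (h : A ≤ B) : Dual B →L[ℂ] Dual A :=
  (ContinuousLinearMap.compL ℂ A B ℂ).flip (incl h).toContinuousLinearMap

theorem restrict_apply {A B : Subalgebra ℂ W} (h : A ≤ B) (ψ : Dual B) (a : A) :
    restrict h ψ a = ψ ⟨(a : W), h a.2⟩ := rfl

/-- The canonical embedding of `A**` in `B**`, `Λ ↦ (ψ ↦ Λ (ψ|_A))`. -/
def bidualIncl {A B : Subalgebra ℂ W} (h : A ≤ B) (Λ : Bidual A) :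
    Bidual B :=
  Λ.comp (restrict h)

/-- The Gleason-Whitney property relative to `W`: each Hahn-Banach (norm-preserving) extension
to `B` of an absolutely continuous functional on `A` is absolutely continuous. -/
def HasGleasonWhitney (e : W ≃ₗᵢ[ℂ] StrongDual ℂ P) {A B : Subalgebra ℂ W} (h : A ≤ B) : Prop :=
  ∀ φ ∈ AC e A, ∀ ψ : Dual B, restrict h ψ = φ → ‖ψ‖ = ‖φ‖ → ψ ∈ AC e B

/-- Compatibility of the Lebesgue decompositions: for `ψ = ψa + ψs` in `B*` with `ψa` absolutely
continuous and `ψs` singular, the restrictions of `ψa` and `ψs` to `A` are absolutely continuous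
and singular, respectively. -/
def AreCompatible (e : W ≃ₗᵢ[ℂ] StrongDual ℂ P) {A B : Subalgebra ℂ W} (h : A ≤ B) : Prop :=
  ∀ ψ ψa ψs : Dual B, ψ = ψa + ψs → ψa ∈ AC e B → ψs ∈ SG e B →
    restrict h ψa ∈ AC e A ∧ restrict h ψs ∈ SG e A

end Lebesgue

end GleasonWhitney

end

/-!
The idempotents of both Lebesgue decompositions are multiplications by central projections of the
bidual, and this needs only the norm identity `‖φ‖ = ‖L φ‖ + ‖φ - L φ‖`, not the weak-* topology:
every L-projection of the dual of a unital operator algebra is of this form.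

Write `z φ = (L φ) 1`. Each `*`-representation `π` of `W` on a Hilbert space `H` extends to a map
`extension π` from the bidual of `A` to the operators on `H`, and by Hahn-Banach, the Jordan
decomposition and the GNS construction the vector functionals `a ↦ ⟪ξ, π a ξ⟫` span the dual of
`A`. So it suffices to study the operators `T = extension π z`. As the adjoint of `L` is an
M-projection, the parallelogram law gives `‖T ξ‖² + ‖ξ - T ξ‖² ≤ ‖ξ‖²`. If `φ` is a functional
with `φ 1 = ‖φ‖` then so are `L φ` and `φ - L φ`; both are vector functionals, whose vectors must
be fixed and annihilated by the corresponding `T`. Hence `z φ' = L φ'` (module action) for all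
`φ'` (`IsLProjection.act_dualUnit`), and `T` is an orthogonal projection. The same M-projection
inequality with `π a T` in place of `T` kills the off-diagonal corners of `π a`
(`extension_dualUnit_comm`), so `T` commutes with `π A`, hence with the extension of `π` to the
bidual, and `z` is central. Two commuting idempotents with a common range agree, which gives
uniqueness.

For the equivalences, `zA = zB` and compatibility both say that restriction to `A` intertwines the
two idempotents. If it does, the singular part of a norm-preserving extension of an absolutely
continuous functional restricts to `0`, so it has norm `0`. Conversely, let `S` and `T` be the
projections given by `zA` and `zB` in a representation. Restrictions of absolutely continuous
functionals are absolutely continuous, so `T ≤ S`. If `ξ = S ξ`, the vector functional of `ξ` on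
`B` is a norm-preserving extension of an absolutely continuous functional on `A`, so the
Gleason-Whitney property gives `T ξ = ξ`. Hence `S = T` (`HasGleasonWhitney.bidualIncl_eq`).
-/

noncomputable section

namespace GleasonWhitney

open ContinuousLinearMap

/-! ### Positive functionals on a C*-algebra -/

section Positive

variable {W : Type*} [CStarAlgebra W]

theorem norm_one_le_one : ‖(1 : W)‖ ≤ 1 := by
  rcases subsingleton_or_nontrivial W with _ | _
  · simp [Subsingleton.elim (1 : W) 0]
  · exact CStarRing.norm_one.le

variable [PartialOrder W] [StarOrderedRing W]

open scoped ComplexOrder in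
/-- The complexification of a positive real functional on the self-adjoint part. -/
theorem exists_positiveLinearMap_of_selfAdjoint (f : selfAdjoint W →ₗ[ℝ] ℝ)
    (hf : ∀ x : selfAdjoint W, 0 ≤ x → 0 ≤ f x) :
    ∃ F : W →ₚ[ℂ] ℂ, ∀ x : W, F x = f (realPart x) + Complex.I * f (imaginaryPart x) := by
  let F : W →ₗ[ℂ] ℂ :=
    { toFun := fun x => f (realPart x) + Complex.I * f (imaginaryPart x)
      map_add' := fun x y => by simp; ring
      map_smul' := fun c x => by
        simp only [realPart_smul, imaginaryPart_smul, map_sub, map_add, map_smul, smul_eq_mul,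
          RingHom.id_apply]
        push_cast
        conv_rhs => rw [← Complex.re_add_im c]
        linear_combination (-(c.im * f (imaginaryPart x)) : ℂ) * Complex.I_sq }
  refine ⟨PositiveLinearMap.mk₀ F fun x hx => ?_, fun x => rfl⟩
  have hsa : IsSelfAdjoint x := IsSelfAdjoint.of_nonneg hx
  have h1 : imaginaryPart x = 0 := hsa.imaginaryPart
  have h2 : (realPart x : W) = x := hsa.coe_realPart
  have h3 : 0 ≤ f (realPart x) := hf _ (by rw [← Subtype.coe_le_coe, h2]; exact hx)
  change 0 ≤ (f (realPart x) : ℂ) + Complex.I * f (imaginaryPart x)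
  rw [h1]
  simpa using h3

/-- A bounded real functional on the self-adjoint part of a C*-algebra is dominated by a positive
functional. This is M. Riesz extension: on triples `(x, u, t)`, standing for `x + u 1` in the first
two coordinates, the functional `(0, u, t) ↦ M u + t` is nonnegative on the cone where
`0 ≤ u` and `t ≥ -ℓ c` for some `0 ≤ c ≤ x + u 1`. -/
theorem exists_nonneg_dominating (l : selfAdjoint W →ₗ[ℝ] ℝ) (M : ℝ) (hM : 0 ≤ M)
    (hl : ∀ x, l x ≤ M * ‖(x : W)‖) :
    ∃ f : selfAdjoint W →ₗ[ℝ] ℝ, (∀ x, 0 ≤ x → 0 ≤ f x) ∧ ∀ x, 0 ≤ x → l x ≤ f x := by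
  let s : PointedCone ℝ (selfAdjoint W × ℝ × ℝ) :=
    { carrier := {p | 0 ≤ p.2.1 ∧ ∃ c : selfAdjoint W, 0 ≤ (c : W) ∧
        (c : W) ≤ p.1 + p.2.1 • 1 ∧ - l c ≤ p.2.2}
      zero_mem' := ⟨le_rfl, 0, by simp⟩
      add_mem' := by
        rintro p q ⟨hp, c, hc0, hc1, hc2⟩ ⟨hq, d, hd0, hd1, hd2⟩
        refine ⟨add_nonneg hp hq, c + d, by simpa using add_nonneg hc0 hd0, ?_, ?_⟩
        · have := add_le_add hc1 hd1
          simp only [Prod.fst_add, Prod.snd_add, AddSubgroup.coe_add, add_smul]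
          convert this using 1
          abel
        · simp only [map_add, Prod.snd_add]
          linarith
      smul_mem' := by
        rintro ⟨r, hr⟩ p ⟨hp, c, hc0, hc1, hc2⟩
        refine ⟨mul_nonneg hr hp, r • c, ?_, ?_, ?_⟩
        · simpa using smul_nonneg hr hc0
        · have := smul_le_smul_of_nonneg_left hc1 hr
          rw [smul_add, smul_smul] at this
          exact this
        · have := mul_le_mul_of_nonneg_left hc2 hr
          rw [map_smul, smul_eq_mul, ← mul_neg]
          exact this }
  let G : selfAdjoint W × ℝ × ℝ →ₗ[ℝ] ℝ :=
    M • (LinearMap.fst ℝ ℝ ℝ ∘ₗ LinearMap.snd ℝ _ _) + LinearMap.snd ℝ ℝ ℝ ∘ₗ LinearMap.snd ℝ _ _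
  obtain ⟨g, hg, hgs⟩ := riesz_extension s
    ⟨LinearMap.ker (LinearMap.fst ℝ (selfAdjoint W) (ℝ × ℝ)), G.domRestrict _⟩ (by
      rintro ⟨⟨x, u, t⟩, hx⟩ ⟨hu, c, hc0, hc1, hc2⟩
      simp only [LinearMap.mem_ker, LinearMap.fst_apply] at hx
      subst hx
      change 0 ≤ M * u + t
      have h1 : ‖(c : W)‖ ≤ u := by
        refine (CStarAlgebra.norm_le_norm_of_nonneg_of_le hc0 hc1).trans ?_
        simp only [ZeroMemClass.coe_zero, zero_add, norm_smul, Real.norm_of_nonneg hu]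
        exact mul_le_of_le_one_right hu norm_one_le_one
      have h2 := (hl c).trans (mul_le_mul_of_nonneg_left h1 hM)
      simp only at hc2
      linarith) (by
      rintro ⟨x, u, t⟩
      refine ⟨⟨(0, ‖(x : W)‖ + |u|, -t), by simp⟩, ?_, 0, by simp, ?_, by simp⟩
      · simp only [Prod.mk_add_mk]
        have := neg_abs_le u
        have := norm_nonneg (x : W)
        linarith
      · simp only [Prod.mk_add_mk, ZeroMemClass.coe_zero, zero_add]
        have h1 : -(x : W) ≤ algebraMap ℝ W ‖(x : W)‖ := by
          have := IsSelfAdjoint.le_algebraMap_norm_self (a := -(x : W)) x.2.neg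
          rwa [norm_neg] at this
        have h2 : 0 ≤ (|u| + u) • (1 : W) :=
          smul_nonneg (by have := neg_abs_le u; linarith) zero_le_one
        rw [Algebra.algebraMap_eq_smul_one] at h1
        have h3 := add_nonneg (sub_nonneg.2 h1) h2
        convert h3 using 1
        module)
  refine ⟨g ∘ₗ LinearMap.inl ℝ _ _, fun x hx => ?_, fun x hx => ?_⟩
  · refine hgs _ ⟨le_rfl, 0, le_rfl, ?_, by simp⟩
    change (0 : W) ≤ (x : W) + (0 : ℝ) • (1 : W)
    rw [zero_smul, add_zero]
    exact hx
  · have h1 : 0 ≤ g (x, 0, -l x) := hgs _ ⟨le_rfl, x, hx, by simp, le_rfl⟩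
    have h2 : g (0, 0, -l x) = M * 0 + -l x :=
      hg ⟨(0, 0, -l x), by simp⟩
    have h3 : (x, (0 : ℝ), -l x) = (x, (0 : ℝ × ℝ)) + (0, 0, -l x) := by simp
    rw [h3, map_add, h2] at h1
    simp only [LinearMap.comp_apply, LinearMap.inl_apply]
    linarith

open scoped ComplexOrder in
/-- Jordan decomposition of the complexification of a bounded real functional. -/
theorem exists_positiveLinearMap_sub (l : selfAdjoint W →ₗ[ℝ] ℝ) (M : ℝ) (hM : 0 ≤ M)
    (hl : ∀ x, l x ≤ M * ‖(x : W)‖) :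
    ∃ F G : W →ₚ[ℂ] ℂ, ∀ x : W,
      F x - G x = l (realPart x) + Complex.I * l (imaginaryPart x) := by
  obtain ⟨f, hf, hlf⟩ := exists_nonneg_dominating l M hM hl
  obtain ⟨F, hF⟩ := exists_positiveLinearMap_of_selfAdjoint f hf
  obtain ⟨G, hG⟩ := exists_positiveLinearMap_of_selfAdjoint (f - l)
    fun x hx => sub_nonneg.2 (hlf x hx)
  refine ⟨F, G, fun x => ?_⟩
  rw [hF, hG]
  simp only [LinearMap.sub_apply]
  push_cast
  ring

open scoped ComplexOrder in
/-- Every bounded functional on a C*-algebra is a linear combination of four positive ones. -/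
theorem exists_positiveLinearMap_combination (φ : StrongDual ℂ W) :
    ∃ F₁ F₂ F₃ F₄ : W →ₚ[ℂ] ℂ, ∀ x, φ x = (F₁ x - F₂ x) + Complex.I * (F₃ x - F₄ x) := by
  let ι : selfAdjoint W →ₗ[ℝ] W := (selfAdjoint.submodule ℝ W).subtype
  let φr : W →ₗ[ℝ] ℂ := (φ : W →ₗ[ℂ] ℂ).restrictScalars ℝ
  obtain ⟨F₁, F₂, h⟩ := exists_positiveLinearMap_sub
    (Complex.reLm ∘ₗ φr ∘ₗ ι) ‖φ‖ (norm_nonneg _)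
    fun x => (Complex.re_le_norm _).trans (φ.le_opNorm _)
  obtain ⟨F₃, F₄, h'⟩ := exists_positiveLinearMap_sub
    (Complex.imLm ∘ₗ φr ∘ₗ ι) ‖φ‖ (norm_nonneg _)
    fun x => (le_abs_self _).trans ((Complex.abs_im_le_norm _).trans (φ.le_opNorm _))
  refine ⟨F₁, F₂, F₃, F₄, fun x => ?_⟩
  rw [h, h']
  change φ x = ((φ (realPart x : W)).re + Complex.I * (φ (imaginaryPart x : W)).re) +
    Complex.I * ((φ (realPart x : W)).im + Complex.I * (φ (imaginaryPart x : W)).im)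
  conv_lhs => rw [← realPart_add_I_smul_imaginaryPart x, map_add, map_smul, smul_eq_mul,
    ← Complex.re_add_im (φ (realPart x : W)), ← Complex.re_add_im (φ (imaginaryPart x : W))]
  ring

open scoped ComplexOrder in
/-- A functional that attains its norm at the unit is positive. -/
theorem nonneg_of_apply_one_eq_norm (φ : StrongDual ℂ W) (h : φ 1 = (‖φ‖ : ℂ)) {x : W}
    (hx : 0 ≤ x) : 0 ≤ φ x := by
  have hsa : IsSelfAdjoint x := IsSelfAdjoint.of_nonneg hx
  -- the imaginary part vanishes: compare `‖φ (x + i t)‖` with `‖x + i t‖` for large real `t`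
  have him : (φ x).im = 0 := by
    have key : ∀ t : ℝ, 2 * t * ((φ x).im * ‖φ‖) + (φ x).im ^ 2 ≤ ‖φ‖ ^ 2 * ‖x‖ ^ 2 := by
      intro t
      have h1 : ‖x + (Complex.I * t) • (1 : W)‖ ^ 2 ≤ ‖x‖ ^ 2 + t ^ 2 := by
        have h2 : star (x + (Complex.I * t) • (1 : W)) * (x + (Complex.I * t) • (1 : W))
            = x * x + ((t ^ 2 : ℝ) : ℂ) • (1 : W) := by
          simp only [star_add, star_smul, star_one, hsa.star_eq, add_mul, mul_add, smul_mul_assoc,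
            mul_smul_comm, one_mul, mul_one]
          have : star (Complex.I * (t : ℂ)) = -(Complex.I * t) := by simp
          rw [this]
          have h3 : -(Complex.I * (t : ℂ)) * (Complex.I * t) = ((t ^ 2 : ℝ) : ℂ) := by
            push_cast
            linear_combination (-(t : ℂ) ^ 2) * Complex.I_sq
          rw [← h3]
          module
        rw [sq, ← CStarRing.norm_star_mul_self, h2]
        refine (norm_add_le _ _).trans (add_le_add ?_ ?_)
        · rw [sq]; exact norm_mul_le _ _
        · rw [norm_smul, Complex.norm_real, Real.norm_of_nonneg (sq_nonneg t)]
          exact mul_le_of_le_one_right (sq_nonneg t) norm_one_le_one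
      have h4 := φ.le_opNorm (x + (Complex.I * t) • (1 : W))
      rw [map_add, map_smul, h, smul_eq_mul] at h4
      have h5 : |(φ x).im + t * ‖φ‖| ≤ ‖φ‖ * ‖x + (Complex.I * t) • (1 : W)‖ := by
        refine le_trans ?_ ((Complex.abs_im_le_norm _).trans h4)
        simp
      have h6 := pow_le_pow_left₀ (abs_nonneg _) h5 2
      rw [sq_abs, mul_pow] at h6
      nlinarith [mul_le_mul_of_nonneg_left h1 (sq_nonneg ‖φ‖)]
    by_contra hne
    have hpos : 0 < ‖φ‖ := by
      rw [norm_pos_iff]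
      rintro rfl
      simp at hne
    have hk : (φ x).im * ‖φ‖ ≠ 0 := mul_ne_zero hne hpos.ne'
    have := key ((‖φ‖ ^ 2 * ‖x‖ ^ 2) / (2 * ((φ x).im * ‖φ‖)))
    have e1 : 2 * ((‖φ‖ ^ 2 * ‖x‖ ^ 2) / (2 * ((φ x).im * ‖φ‖))) * ((φ x).im * ‖φ‖)
        = ‖φ‖ ^ 2 * ‖x‖ ^ 2 := by
      field_simp
    have e2 : 0 < (φ x).im ^ 2 := by positivity
    linarith
  -- the real part is nonnegative, since `‖‖x‖ - x‖ ≤ ‖x‖`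
  have hre : 0 ≤ (φ x).re := by
    have h1 : ‖(‖x‖ : ℂ) • (1 : W) - x‖ ≤ ‖x‖ := by
      have h2 : x ≤ (‖x‖ : ℂ) • (1 : W) := by
        have := IsSelfAdjoint.le_algebraMap_norm_self (a := x) hsa
        rw [Algebra.algebraMap_eq_smul_one] at this
        simpa using this
      refine (CStarAlgebra.norm_le_norm_of_nonneg_of_le (sub_nonneg.2 h2)
        (sub_le_self _ hx)).trans ?_
      rw [norm_smul, Complex.norm_real, norm_norm]
      exact mul_le_of_le_one_right (norm_nonneg _) norm_one_le_one
    have h3 := (Complex.re_le_norm _).trans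
      ((φ.le_opNorm _).trans (mul_le_mul_of_nonneg_left h1 (norm_nonneg φ)))
    rw [map_sub, map_smul, h] at h3
    simp only [smul_eq_mul, Complex.sub_re, ← Complex.ofReal_mul, Complex.ofReal_re] at h3
    linarith
  exact Complex.nonneg_iff.2 ⟨hre, him.symm⟩

open scoped ComplexOrder in
/-- The class of the unit in the GNS space. -/
def gnsVector (f : W →ₚ[ℂ] ℂ) : f.GNS := (f.toPreGNS 1 : f.PreGNS)

open scoped ComplexOrder InnerProductSpace in
theorem inner_gnsStarAlgHom (f : W →ₚ[ℂ] ℂ) (x : W) :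
    ⟪gnsVector f, f.gnsStarAlgHom x (gnsVector f)⟫_ℂ = f x := by
  change ⟪((f.toPreGNS 1 : f.PreGNS) : f.GNS),
    f.gnsNonUnitalStarAlgHom x ((f.toPreGNS 1 : f.PreGNS) : f.GNS)⟫_ℂ = f x
  rw [PositiveLinearMap.gnsNonUnitalStarAlgHom_apply_coe, UniformSpace.Completion.inner_coe,
    PositiveLinearMap.preGNS_inner_def]
  simp

end Positive

/-! ### Vector functionals and the extension of representations to the bidual -/

section Representation

universe u

variable {W : Type u} [CStarAlgebra W]
variable {H : Type*} [NormedAddCommGroup H] [InnerProductSpace ℂ H] [CompleteSpace H]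

open scoped InnerProductSpace

/-- The functional `a ↦ ⟪η, π a ξ⟫` on a subalgebra `A` of `W`, for a representation `π` of `W`. -/
def vectorFunctional (A : Subalgebra ℂ W) (π : W →⋆ₐ[ℂ] (H →L[ℂ] H)) (ξ η : H) : Dual A :=
  LinearMap.mkContinuous
    { toFun := fun a => ⟪η, π a ξ⟫_ℂ
      map_add' := fun a b => by simp
      map_smul' := fun c a => by simp }
    (‖ξ‖ * ‖η‖) fun a => by
      change ‖⟪η, π a ξ⟫_ℂ‖ ≤ ‖ξ‖ * ‖η‖ * ‖(a : W)‖
      calc ‖⟪η, π a ξ⟫_ℂ‖ ≤ ‖η‖ * ‖π a ξ‖ := norm_inner_le_norm _ _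
        _ ≤ ‖η‖ * (‖(a : W)‖ * ‖ξ‖) := by
          gcongr
          exact (le_opNorm _ _).trans
            (mul_le_mul_of_nonneg_right (NonUnitalStarAlgHom.norm_apply_le π _) (norm_nonneg _))
        _ = ‖ξ‖ * ‖η‖ * ‖(a : W)‖ := by ring

variable {A B : Subalgebra ℂ W} (π : W →⋆ₐ[ℂ] (H →L[ℂ] H))

@[simp]
theorem vectorFunctional_apply (ξ η : H) (a : A) :
    vectorFunctional A π ξ η a = ⟪η, π a ξ⟫_ℂ := rfl

theorem norm_vectorFunctional_le (ξ η : H) : ‖vectorFunctional A π ξ η‖ ≤ ‖ξ‖ * ‖η‖ :=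
  LinearMap.mkContinuous_norm_le _ (by positivity) _

theorem vectorFunctional_one (ξ η : H) : vectorFunctional A π ξ η 1 = ⟪η, ξ⟫_ℂ := by
  simp

theorem norm_vectorFunctional_self (ξ : H) : ‖vectorFunctional A π ξ ξ‖ = ‖ξ‖ ^ 2 := by
  refine le_antisymm ((norm_vectorFunctional_le π ξ ξ).trans_eq (sq _).symm) ?_
  have h := (vectorFunctional A π ξ ξ).le_opNorm 1
  rw [vectorFunctional_one, inner_self_eq_norm_sq_to_K, norm_pow, RCLike.norm_ofReal,
    abs_norm] at h
  exact h.trans (mul_le_of_le_one_right (norm_nonneg _) norm_one_le_one)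

theorem vectorFunctional_one_eq_norm (ξ : H) :
    vectorFunctional A π ξ ξ 1 = (‖vectorFunctional A π ξ ξ‖ : ℂ) := by
  rw [vectorFunctional_one, norm_vectorFunctional_self, inner_self_eq_norm_sq_to_K]
  simp

theorem rightMul_vectorFunctional (ξ η : H) (a : A) :
    rightMul (vectorFunctional A π ξ η) a = vectorFunctional A π ξ (adjoint (π a) η) := by
  ext b
  simp [rightMul, adjoint_inner_left]

theorem restrict_vectorFunctional (h : A ≤ B) (ξ η : H) :
    restrict h (vectorFunctional B π ξ η) = vectorFunctional A π ξ η := rfl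

/-- The extension of a representation of `W` to the bidual of a subalgebra `A`, determined by
`⟪η, extension π Λ ξ⟫ = Λ (a ↦ ⟪η, π a ξ⟫)`. -/
def extension (Λ : Bidual A) : H →L[ℂ] H :=
  adjoint <| InnerProductSpace.continuousLinearMapOfBilin <|
    LinearMap.mkContinuous₂
      (LinearMap.mk₂'ₛₗ (starRingEnd ℂ) (RingHom.id ℂ)
        (fun η ξ => Λ (vectorFunctional A π ξ η))
        (fun η η' ξ => by
          rw [← map_add]; congr 1; ext a; simp)
        (fun c η ξ => by
          rw [smul_eq_mul, ← smul_eq_mul, ← map_smul]; congr 1; ext a; simp [mul_comm])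
        (fun η ξ ξ' => by
          rw [← map_add]; congr 1; ext a; simp)
        (fun c η ξ => by
          rw [RingHom.id_apply, ← map_smul]; congr 1; ext a; simp))
      ‖Λ‖ fun η ξ => (Λ.le_opNorm _).trans <| by
        rw [mul_assoc, mul_comm ‖η‖]
        exact mul_le_mul_of_nonneg_left (norm_vectorFunctional_le π ξ η) (norm_nonneg _)

theorem inner_extension (Λ : Bidual A) (ξ η : H) :
    ⟪η, extension π Λ ξ⟫_ℂ = Λ (vectorFunctional A π ξ η) := by
  rw [extension, adjoint_inner_right, InnerProductSpace.continuousLinearMapOfBilin_apply]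
  rfl

theorem extension_add (Λ Ξ : Bidual A) :
    extension π (Λ + Ξ) = extension π Λ + extension π Ξ := by
  ext ξ
  refine ext_inner_left ℂ fun η => ?_
  simp [inner_add_right, inner_extension]

theorem extension_sub (Λ Ξ : Bidual A) :
    extension π (Λ - Ξ) = extension π Λ - extension π Ξ := by
  ext ξ
  refine ext_inner_left ℂ fun η => ?_
  simp [inner_sub_right, inner_extension]

/-- Evaluation at `a`, as an element of the bidual. -/
def evalAt (a : A) : Bidual A := ContinuousLinearMap.apply ℂ ℂ a

@[simp]
theorem evalAt_apply (a : A) (φ : Dual A) : evalAt a φ = φ a := rfl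

theorem norm_evalAt_le (a : A) : ‖evalAt a‖ ≤ ‖a‖ :=
  opNorm_le_bound _ (norm_nonneg _) fun φ => by
    rw [evalAt_apply, mul_comm]
    exact φ.le_opNorm a

theorem extension_evalAt (a : A) : extension π (evalAt a) = π a := by
  ext ξ
  refine ext_inner_left ℂ fun η => ?_
  simp [inner_extension]

theorem norm_extension_le (Λ : Bidual A) : ‖extension π Λ‖ ≤ ‖Λ‖ := by
  refine opNorm_le_bound _ (norm_nonneg Λ) fun ξ => ?_
  have h : ‖extension π Λ ξ‖ ^ 2 ≤ ‖Λ‖ * ‖ξ‖ * ‖extension π Λ ξ‖ := by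
    rw [← inner_self_eq_norm_sq (𝕜 := ℂ), inner_extension, mul_assoc]
    exact (RCLike.re_le_norm _).trans <| (Λ.le_opNorm _).trans
      (mul_le_mul_of_nonneg_left (norm_vectorFunctional_le π _ _) (norm_nonneg _))
  rcases (norm_nonneg (extension π Λ ξ)).eq_or_lt with h0 | h0
  · rw [← h0]; positivity
  · exact le_of_mul_le_mul_right (by rwa [sq] at h) h0

theorem act_vectorFunctional (Λ : Bidual A) (ξ η : H) :
    act Λ (vectorFunctional A π ξ η) = vectorFunctional A π (extension π Λ ξ) η := by
  ext a
  rw [act_apply, rightMul_vectorFunctional, ← inner_extension, adjoint_inner_left]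
  rfl

/-- An operator in the commutant of `π A` commutes with the extension of `π` to the bidual. -/
theorem extension_apply_comm (Λ : Bidual A) (T : H →L[ℂ] H)
    (hT : ∀ (a : A) (ξ : H), T (π a ξ) = π a (T ξ)) (ξ : H) :
    T (extension π Λ ξ) = extension π Λ (T ξ) := by
  refine ext_inner_left ℂ fun η => ?_
  rw [inner_extension, ← adjoint_inner_left, inner_extension]
  congr 1
  ext a
  simp [adjoint_inner_left, hT]

open scoped ComplexOrder in
/-- Every functional on `A` that attains its norm at the unit is a vector functional. -/
theorem exists_eq_vectorFunctional (φ : Dual A) (h : φ 1 = (‖φ‖ : ℂ)) :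
    ∃ (H : Type u) (_ : NormedAddCommGroup H) (_ : InnerProductSpace ℂ H) (_ : CompleteSpace H)
      (π : W →⋆ₐ[ℂ] (H →L[ℂ] H)) (ξ : H), φ = vectorFunctional A π ξ ξ := by
  let _ := CStarAlgebra.spectralOrder W
  have := CStarAlgebra.spectralOrderedRing W
  obtain ⟨g, hg, hn⟩ := exists_extension_norm_eq (𝕜 := ℂ) (Subalgebra.toSubmodule A) φ
  have hg1 : g 1 = (‖g‖ : ℂ) := by
    rw [hn]
    exact (hg ⟨1, A.one_mem⟩).trans h
  let f := PositiveLinearMap.mk₀ (g : W →ₗ[ℂ] ℂ) fun x hx =>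
    nonneg_of_apply_one_eq_norm g hg1 hx
  refine ⟨f.GNS, inferInstance, inferInstance, inferInstance, f.gnsStarAlgHom, gnsVector f, ?_⟩
  ext a
  exact (hg a).symm.trans (inner_gnsStarAlgHom f a).symm

open scoped ComplexOrder in
/-- The functionals `a ↦ ⟪ξ, π a ξ⟫` span the dual of `A`. -/
theorem mem_of_vectorFunctional_mem (S : Submodule ℂ (Dual A))
    (hS : ∀ (H : Type u) [NormedAddCommGroup H] [InnerProductSpace ℂ H] [CompleteSpace H]
      (π : W →⋆ₐ[ℂ] (H →L[ℂ] H)) (ξ : H), vectorFunctional A π ξ ξ ∈ S) (φ : Dual A) :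
    φ ∈ S := by
  let _ := CStarAlgebra.spectralOrder W
  have := CStarAlgebra.spectralOrderedRing W
  obtain ⟨g, hg, -⟩ := exists_extension_norm_eq (𝕜 := ℂ) (Subalgebra.toSubmodule A) φ
  obtain ⟨F₁, F₂, F₃, F₄, h⟩ := exists_positiveLinearMap_combination g
  let ω (F : W →ₚ[ℂ] ℂ) := vectorFunctional A F.gnsStarAlgHom (gnsVector F) (gnsVector F)
  have key : φ = (ω F₁ - ω F₂) + Complex.I • (ω F₃ - ω F₄) := by
    ext a
    refine ((hg a).symm.trans (h a)).trans ?_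
    simp only [← inner_gnsStarAlgHom]
    rfl
  rw [key]
  exact S.add_mem (S.sub_mem (hS _ _ _) (hS _ _ _))
    (S.smul_mem _ (S.sub_mem (hS _ _ _) (hS _ _ _)))

end Representation

/-! ### L-projections are given by central projections -/

section LProjection

universe u

variable {W : Type u} [CStarAlgebra W] {A : Subalgebra ℂ W}

open scoped InnerProductSpace

/-- `L` is an L-projection of the dual of `A`: a bounded idempotent with
`‖φ‖ = ‖L φ‖ + ‖φ - L φ‖`. -/
structure IsLProjection (L : Dual A →L[ℂ] Dual A) : Prop where
  idem : ∀ φ : Dual A, L (L φ) = L φ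
  norm_eq : ∀ φ : Dual A, ‖φ‖ = ‖L φ‖ + ‖φ - L φ‖

/-- The element of the bidual attached to an L-projection `L`: the image of the unit under the
adjoint of `L`. -/
def dualUnit (L : Dual A →L[ℂ] Dual A) : Bidual A := (evalAt 1).comp L

@[simp]
theorem dualUnit_apply (L : Dual A →L[ℂ] Dual A) (φ : Dual A) : dualUnit L φ = L φ 1 := rfl

theorem act_apply_one (Λ : Bidual A) (φ : Dual A) : act Λ φ 1 = Λ φ := by
  rw [act_apply]
  congr 1
  ext b
  simp [rightMul]

theorem act_injective {Λ Ξ : Bidual A} (h : ∀ φ, act Λ φ = act Ξ φ) : Λ = Ξ := by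
  ext φ
  rw [← act_apply_one, h, act_apply_one]

theorem rightMul_act (Ξ : Bidual A) (φ : Dual A) (a : A) :
    rightMul (act Ξ φ) a = act Ξ (rightMul φ a) := by
  ext b
  change Ξ (rightMul φ (a * b)) = Ξ (rightMul (rightMul φ a) b)
  congr 1
  ext c
  simp [rightMul, mul_assoc]

theorem act_arens (Λ Ξ : Bidual A) (φ : Dual A) : act (arens Λ Ξ) φ = act Λ (act Ξ φ) := by
  ext a
  rw [act_apply, arens_apply, act_apply, rightMul_act]

section Operators

variable {H : Type*} [NormedAddCommGroup H] [InnerProductSpace ℂ H]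

theorem norm_sq_add_norm_sq_le {X Y : H →L[ℂ] H} {c : ℝ} (h₁ : ‖X + Y‖ ≤ c) (h₂ : ‖X - Y‖ ≤ c)
    (ξ : H) : ‖X ξ‖ ^ 2 + ‖Y ξ‖ ^ 2 ≤ c ^ 2 * ‖ξ‖ ^ 2 := by
  have e := parallelogram_law_with_norm ℂ (X ξ) (Y ξ)
  have k₁ : ‖X ξ + Y ξ‖ ≤ c * ‖ξ‖ := (X + Y).le_of_opNorm_le h₁ ξ
  have k₂ : ‖X ξ - Y ξ‖ ≤ c * ‖ξ‖ := (X - Y).le_of_opNorm_le h₂ ξ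
  have l₁ := mul_self_le_mul_self (norm_nonneg _) k₁
  have l₂ := mul_self_le_mul_self (norm_nonneg _) k₂
  nlinarith

theorem apply_eq_self_of_inner_eq {T : H →L[ℂ] H} {ξ : H}
    (hT : ‖T ξ‖ ^ 2 + ‖ξ - T ξ‖ ^ 2 ≤ ‖ξ‖ ^ 2) (h : ⟪ξ, T ξ⟫_ℂ = ⟪ξ, ξ⟫_ℂ) : T ξ = ξ := by
  have e := norm_sub_sq (𝕜 := ℂ) ξ (T ξ)
  rw [h, inner_self_eq_norm_sq] at e
  have : ‖ξ - T ξ‖ = 0 := by nlinarith [norm_nonneg (ξ - T ξ)]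
  exact (sub_eq_zero.1 (norm_eq_zero.1 this)).symm

theorem apply_eq_zero_of_inner_eq_zero {T : H →L[ℂ] H} {ξ : H}
    (hT : ‖T ξ‖ ^ 2 + ‖ξ - T ξ‖ ^ 2 ≤ ‖ξ‖ ^ 2) (h : ⟪ξ, T ξ⟫_ℂ = 0) : T ξ = 0 := by
  have e := norm_sub_sq (𝕜 := ℂ) ξ (T ξ)
  rw [h, map_zero] at e
  have : ‖T ξ‖ = 0 := by nlinarith [norm_nonneg (T ξ)]
  exact norm_eq_zero.1 this

/-- If `(X† ζ, c S ζ)` has norm at most `c ‖ζ‖` for all `ζ`, then `X†` vanishes on the range of the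
orthogonal projection `S`, where `c S` alone exhausts the bound. -/
theorem apply_apply_eq_zero [CompleteSpace H] {S X : H →L[ℂ] H} (hS : IsSelfAdjoint S)
    (hid : ∀ ζ, S (S ζ) = S ζ) (c : ℝ)
    (h : ∀ ζ, ‖adjoint X ζ‖ ^ 2 + (c * ‖S ζ‖) ^ 2 ≤ c ^ 2 * ‖ζ‖ ^ 2) (ξ : H) : S (X ξ) = 0 := by
  have key : ∀ ζ, adjoint X (S ζ) = 0 := fun ζ => by
    have h' := h (S ζ)
    rw [hid, mul_pow] at h'
    have : ‖adjoint X (S ζ)‖ = 0 := by nlinarith [norm_nonneg (adjoint X (S ζ))]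
    exact norm_eq_zero.1 this
  refine ext_inner_left ℂ fun η => ?_
  rw [inner_zero_right, ← adjoint_inner_left, hS.adjoint_eq, ← adjoint_inner_left, key,
    inner_zero_left]

end Operators

namespace IsLProjection

variable {L : Dual A →L[ℂ] Dual A} (hL : IsLProjection L)
include hL

/-- The adjoint of an L-projection is an M-projection. -/
theorem norm_comp_add_comp_le {Λ Ξ : Bidual A} {c : ℝ} (hΛ : ‖Λ‖ ≤ c) (hΞ : ‖Ξ‖ ≤ c) :
    ‖Λ.comp L + Ξ.comp (1 - L)‖ ≤ c := by
  refine opNorm_le_bound _ ((norm_nonneg Λ).trans hΛ) fun φ => ?_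
  rw [hL.norm_eq φ, mul_add]
  exact (norm_add_le _ _).trans
    (add_le_add (Λ.le_of_opNorm_le hΛ _) (Ξ.le_of_opNorm_le hΞ _))

/-- An L-projection and its complement preserve the functionals that attain
their norm at the unit, as the two parts cannot share the norm otherwise. -/
theorem apply_one_eq_norm {φ : Dual A} (h : φ 1 = (‖φ‖ : ℂ)) :
    L φ 1 = (‖L φ‖ : ℂ) ∧ (φ - L φ) 1 = (‖φ - L φ‖ : ℂ) := by
  have hle : ∀ ψ : Dual A, ‖ψ 1‖ ≤ ‖ψ‖ := fun ψ =>
    (ψ.le_opNorm 1).trans (mul_le_of_le_one_right (norm_nonneg _) norm_one_le_one)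
  have h1 := hle (L φ)
  have h2 := hle (φ - L φ)
  have h3 := Complex.re_le_norm (L φ 1)
  have h4 := Complex.re_le_norm ((φ - L φ) 1)
  have h5 : (L φ 1).re + ((φ - L φ) 1).re = ‖L φ‖ + ‖φ - L φ‖ := by
    rw [← hL.norm_eq, ← Complex.add_re, ← add_apply, add_sub_cancel, h, Complex.ofReal_re]
  have key : ∀ {w : ℂ} {r : ℝ}, ‖w‖ ≤ r → w.re = r → w = r := fun {w r} hw hr => by
    have h0 : 0 ≤ w.re := hr ▸ (norm_nonneg w).trans hw
    have h6 : w.re = ‖w‖ := le_antisymm (Complex.re_le_norm w) (hr ▸ hw)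
    have h7 : w.im = 0 := by
      have := Complex.sq_norm w
      rw [← h6, Complex.normSq_apply] at this
      nlinarith
    exact Complex.ext hr h7
  exact ⟨key h1 (by linarith), key h2 (by linarith)⟩

section Rep

variable {H : Type*} [NormedAddCommGroup H] [InnerProductSpace ℂ H] [CompleteSpace H]
  (π : W →⋆ₐ[ℂ] (H →L[ℂ] H))

theorem norm_sq_extension_add_le {Λ Ξ : Bidual A} {c : ℝ} (hΛ : ‖Λ‖ ≤ c) (hΞ : ‖Ξ‖ ≤ c) (ξ : H) :
    ‖extension π (Λ.comp L) ξ‖ ^ 2 + ‖extension π (Ξ.comp (1 - L)) ξ‖ ^ 2 ≤ c ^ 2 * ‖ξ‖ ^ 2 ∧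
    ‖adjoint (extension π (Λ.comp L)) ξ‖ ^ 2 + ‖adjoint (extension π (Ξ.comp (1 - L))) ξ‖ ^ 2
      ≤ c ^ 2 * ‖ξ‖ ^ 2 := by
  have h₁ : ‖extension π (Λ.comp L) + extension π (Ξ.comp (1 - L))‖ ≤ c := by
    rw [← extension_add]
    exact (norm_extension_le _ _).trans (hL.norm_comp_add_comp_le hΛ hΞ)
  have h₂ : ‖extension π (Λ.comp L) - extension π (Ξ.comp (1 - L))‖ ≤ c := by
    have e : Λ.comp L - Ξ.comp (1 - L) = Λ.comp L + (-Ξ).comp (1 - L) := by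
      ext φ
      change Λ (L φ) - Ξ ((1 - L) φ) = Λ (L φ) + -Ξ ((1 - L) φ)
      ring
    rw [← extension_sub, e]
    exact (norm_extension_le _ _).trans (hL.norm_comp_add_comp_le hΛ (by rwa [opNorm_neg]))
  refine ⟨norm_sq_add_norm_sq_le h₁ h₂ ξ, norm_sq_add_norm_sq_le ?_ ?_ ξ⟩
  · rwa [← map_add, LinearIsometryEquiv.norm_map]
  · rwa [← map_sub, LinearIsometryEquiv.norm_map]

omit hL in
theorem extension_evalAt_comp_one_sub (a : A) :
    extension π ((evalAt a).comp (1 - L)) = π a - extension π ((evalAt a).comp L) := by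
  rw [comp_sub, extension_sub, one_def, comp_id, extension_evalAt]

theorem norm_sq_extension_dualUnit_le (ξ : H) :
    ‖extension π (dualUnit L) ξ‖ ^ 2 + ‖ξ - extension π (dualUnit L) ξ‖ ^ 2 ≤ ‖ξ‖ ^ 2 := by
  have h1 : ‖evalAt (1 : A)‖ ≤ 1 := (norm_evalAt_le _).trans norm_one_le_one
  have h := (hL.norm_sq_extension_add_le π h1 h1 ξ).1
  rw [extension_evalAt_comp_one_sub] at h
  simpa [dualUnit] using h

end Rep

/-- An L-projection is the action of an element of the bidual. For a state `φ`, both `L φ` and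
`φ - L φ` are multiples of states, and the cyclic vectors of their representations are fixed and
annihilated, respectively, by `dualUnit L`. -/
theorem act_dualUnit (φ : Dual A) : act (dualUnit L) φ = L φ := by
  refine mem_of_vectorFunctional_mem
    (LinearMap.eqLocus (act (dualUnit L) : Dual A →ₗ[ℂ] Dual A) (L : Dual A →ₗ[ℂ] Dual A))
    (fun H _ _ _ π ξ => ?_) φ
  rw [LinearMap.mem_eqLocus]
  change act (dualUnit L) (vectorFunctional A π ξ ξ) = L (vectorFunctional A π ξ ξ)
  set ω := vectorFunctional A π ξ ξ
  obtain ⟨h₁, h₂⟩ := hL.apply_one_eq_norm (vectorFunctional_one_eq_norm (A := A) π ξ)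
  have e₁ : act (dualUnit L) (L ω) = L ω := by
    obtain ⟨H₁, _, _, _, π₁, ξ₁, e⟩ := exists_eq_vectorFunctional (L ω) h₁
    rw [e, act_vectorFunctional, apply_eq_self_of_inner_eq
      (hL.norm_sq_extension_dualUnit_le π₁ ξ₁)]
    rw [inner_extension, dualUnit_apply, ← e, hL.idem, e, vectorFunctional_one]
  have e₂ : act (dualUnit L) (ω - L ω) = 0 := by
    obtain ⟨H₂, _, _, _, π₂, ξ₂, e⟩ := exists_eq_vectorFunctional (ω - L ω) h₂
    rw [e, act_vectorFunctional, apply_eq_zero_of_inner_eq_zero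
      (hL.norm_sq_extension_dualUnit_le π₂ ξ₂)]
    · ext a; simp
    · rw [inner_extension, dualUnit_apply, ← e, map_sub, hL.idem, sub_self, zero_apply]
  rw [map_sub, e₁, sub_eq_zero] at e₂
  exact e₂

section Rep

variable {H : Type*} [NormedAddCommGroup H] [InnerProductSpace ℂ H] [CompleteSpace H]
  (π : W →⋆ₐ[ℂ] (H →L[ℂ] H))

theorem apply_vectorFunctional (ξ η : H) :
    L (vectorFunctional A π ξ η) = vectorFunctional A π (extension π (dualUnit L) ξ) η := by
  rw [← hL.act_dualUnit, act_vectorFunctional]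

theorem extension_dualUnit_idem (ξ : H) :
    extension π (dualUnit L) (extension π (dualUnit L) ξ) = extension π (dualUnit L) ξ := by
  refine ext_inner_left ℂ fun η => ?_
  rw [inner_extension, inner_extension, dualUnit_apply, dualUnit_apply,
    ← hL.apply_vectorFunctional, hL.idem]

theorem isSelfAdjoint_extension_dualUnit : IsSelfAdjoint (extension π (dualUnit L)) := by
  rw [ContinuousLinearMap.isSelfAdjoint_iff_isSymmetric,
    LinearMap.isSymmetric_iff_inner_map_self_real]
  intro ξ
  rw [inner_conj_symm]
  have h : ⟪ξ, extension π (dualUnit L) ξ⟫_ℂ = (‖L (vectorFunctional A π ξ ξ)‖ : ℂ) := by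
    rw [inner_extension, dualUnit_apply]
    exact (hL.apply_one_eq_norm (vectorFunctional_one_eq_norm π ξ)).1
  change ⟪ξ, extension π (dualUnit L) ξ⟫_ℂ = ⟪extension π (dualUnit L) ξ, ξ⟫_ℂ
  rw [← inner_conj_symm (extension π (dualUnit L) ξ), h, Complex.conj_ofReal]

theorem extension_evalAt_comp (a : A) :
    extension π ((evalAt a).comp L) = π a ∘L extension π (dualUnit L) := by
  ext ξ
  refine ext_inner_left ℂ fun η => ?_
  rw [inner_extension]
  change L (vectorFunctional A π ξ η) a = _
  rw [hL.apply_vectorFunctional]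
  rfl

/-- The projection `extension π (dualUnit L)` lies in the commutant of `π A`: with `T` this
projection, the M-projection property bounds `(π a T, ‖a‖ (1 - T))` and `(‖a‖ T, π a (1 - T))`,
which forces the off-diagonal parts `(1 - T) π a T` and `T π a (1 - T)` to vanish. -/
theorem extension_dualUnit_comm (a : A) (ξ : H) :
    extension π (dualUnit L) (π a ξ) = π a (extension π (dualUnit L) ξ) := by
  have hsa := hL.isSelfAdjoint_extension_dualUnit π
  have hid := hL.extension_dualUnit_idem π
  let u : A := (‖a‖ : ℂ) • 1
  have hu : ‖evalAt u‖ ≤ ‖a‖ := (norm_evalAt_le u).trans <| by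
    rw [norm_smul, Complex.norm_real, norm_norm]
    exact mul_le_of_le_one_right (norm_nonneg _) norm_one_le_one
  have hπu : π u = (‖a‖ : ℂ) • (1 : H →L[ℂ] H) :=
    (map_smul π (‖a‖ : ℂ) (1 : W)).trans (by rw [map_one])
  have k₁ := fun ζ => (hL.norm_sq_extension_add_le π (norm_evalAt_le a) hu ζ).2
  have k₂ := fun ζ => (hL.norm_sq_extension_add_le π hu (norm_evalAt_le a) ζ).2
  simp only [extension_evalAt_comp_one_sub, hL.extension_evalAt_comp, hπu] at k₁ k₂
  generalize extension π (dualUnit L) = T at *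
  have hadj : ∀ (S : H →L[ℂ] H) (ζ : H), IsSelfAdjoint S →
      ‖adjoint ((‖a‖ : ℂ) • S) ζ‖ = ‖a‖ * ‖S ζ‖ := fun S ζ hS => by
    rw [map_smulₛₗ, hS.adjoint_eq, smul_apply, norm_smul, RCLike.norm_conj, Complex.norm_real,
      norm_norm]
  have l₁ : (1 - T) ((π a ∘L T) ξ) = 0 := by
    refine apply_apply_eq_zero ((IsSelfAdjoint.one _).sub hsa) (fun ζ => by simp [hid]) ‖a‖
      (fun ζ => ?_) ξ
    rw [← hadj _ _ ((IsSelfAdjoint.one _).sub hsa)]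
    have e : (‖a‖ : ℂ) • (1 - T) = (‖a‖ : ℂ) • 1 - ((‖a‖ : ℂ) • 1) ∘L T := smul_sub _ _ _
    rw [e]
    exact k₁ ζ
  have l₂ : T ((π a - π a ∘L T) ξ) = 0 := by
    refine apply_apply_eq_zero hsa hid ‖a‖ (fun ζ => ?_) ξ
    rw [← hadj _ _ hsa, add_comm]
    exact k₂ ζ
  have m₁ : π a (T ξ) - T (π a (T ξ)) = 0 := l₁
  have m₂ : T (π a ξ - π a (T ξ)) = 0 := l₂
  rw [map_sub] at m₂
  rw [sub_eq_zero.1 m₂, ← sub_eq_zero.1 m₁]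

end Rep

theorem isCentralProjection_dualUnit : IsCentralProjection (dualUnit L) where
  idem := by
    ext φ
    rw [arens_apply, hL.act_dualUnit, dualUnit_apply, hL.idem, dualUnit_apply]
  norm_le_one := opNorm_le_bound _ zero_le_one fun φ => by
    rw [dualUnit_apply, one_mul]
    refine ((L φ).le_opNorm 1).trans ((mul_le_of_le_one_right (norm_nonneg _)
      norm_one_le_one).trans ?_)
    rw [hL.norm_eq φ]
    exact le_add_of_nonneg_right (norm_nonneg _)
  central Λ := by
    ext φ
    refine mem_of_vectorFunctional_mem
      (LinearMap.eqLocus (arens (dualUnit L) Λ : Dual A →ₗ[ℂ] ℂ)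
        (arens Λ (dualUnit L) : Dual A →ₗ[ℂ] ℂ)) (fun H _ _ _ π ξ => ?_) φ
    rw [LinearMap.mem_eqLocus]
    change dualUnit L (act Λ (vectorFunctional A π ξ ξ)) =
      Λ (act (dualUnit L) (vectorFunctional A π ξ ξ))
    rw [act_vectorFunctional, act_vectorFunctional, ← inner_extension, ← inner_extension,
      extension_apply_comm π Λ _ (hL.extension_dualUnit_comm π)]

end IsLProjection

end LProjection

/-! ### Lebesgue projections and inclusions -/

section Lebesgue

universe u

variable {W : Type u} [CStarAlgebra W] {P : Type*} [NormedAddCommGroup P] [NormedSpace ℂ P]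
  {e : W ≃ₗᵢ[ℂ] StrongDual ℂ P} {A B : Subalgebra ℂ W}

namespace IsLebesgueIdempotent

variable {L : Dual A →L[ℂ] Dual A}

theorem isLProjection (hL : IsLebesgueIdempotent e A L) : IsLProjection L :=
  ⟨hL.idem, hL.norm_eq⟩

theorem isLebesgueProjection_dualUnit (hL : IsLebesgueIdempotent e A L) :
    IsLebesgueProjection e A (dualUnit L) where
  isCentralProjection := hL.isLProjection.isCentralProjection_dualUnit
  range_eq := by
    rw [← hL.range_eq]
    congr 1
    ext1 φ
    exact hL.isLProjection.act_dualUnit φ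

end IsLebesgueIdempotent

namespace IsLebesgueProjection

variable {z z' : Bidual A}

theorem act_eq_self (hz : IsLebesgueProjection e A z) {φ : Dual A} (hφ : φ ∈ AC e A) :
    act z φ = φ := by
  rw [← hz.range_eq] at hφ
  obtain ⟨ψ, rfl⟩ := hφ
  change act z (act z ψ) = act z ψ
  rw [← act_arens, hz.isCentralProjection.idem]

theorem act_mem (hz : IsLebesgueProjection e A z) (φ : Dual A) : act z φ ∈ AC e A := by
  rw [← hz.range_eq]
  exact ⟨φ, rfl⟩

theorem mem_AC_iff (hz : IsLebesgueProjection e A z) {φ : Dual A} :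
    φ ∈ AC e A ↔ act z φ = φ :=
  ⟨hz.act_eq_self, fun h => h ▸ hz.act_mem φ⟩

/-- Two commuting idempotents with the same range coincide. -/
theorem eq (hz : IsLebesgueProjection e A z) (hz' : IsLebesgueProjection e A z') : z = z' :=
  act_injective fun φ => by
    rw [← hz'.act_eq_self (hz.act_mem φ), ← act_arens, ← hz.isCentralProjection.central,
      act_arens, hz.act_eq_self (hz'.act_mem φ)]

theorem act_eq (hz : IsLebesgueProjection e A z) {L : Dual A →L[ℂ] Dual A}
    (hL : IsLebesgueIdempotent e A L) (φ : Dual A) : act z φ = L φ := by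
  rw [hz.eq hL.isLebesgueProjection_dualUnit, hL.isLProjection.act_dualUnit]

end IsLebesgueProjection

theorem mem_SG_iff {z : Bidual A} (hz : IsLebesgueProjection e A z) {L : Dual A →L[ℂ] Dual A}
    (hL : IsLebesgueIdempotent e A L) {φ : Dual A} : φ ∈ SG e A ↔ act z φ = 0 :=
  ⟨fun ⟨_, hL', h⟩ => (hz.act_eq hL' φ).trans h, fun h => ⟨L, hL, (hz.act_eq hL φ).symm.trans h⟩⟩

theorem existsUnique_isLebesgueProjection (hA : AdmitsLebesgueDecomposition e A) :
    ∃! z : Bidual A, IsLebesgueProjection e A z := by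
  obtain ⟨L, hL⟩ := hA
  exact ⟨_, hL.isLebesgueProjection_dualUnit,
    fun z hz => hz.eq hL.isLebesgueProjection_dualUnit⟩

section Inclusion

variable (h : A ≤ B) {zA : Bidual A} {zB : Bidual B}

theorem restrict_mem_AC {ψ : Dual B} (hψ : ψ ∈ AC e B) : restrict h ψ ∈ AC e A := by
  obtain ⟨Φ, hΦ, hψ⟩ := hψ
  exact ⟨Φ, hΦ, fun a => hψ ⟨a, h a.2⟩⟩

theorem norm_restrict_le (ψ : Dual B) : ‖restrict h ψ‖ ≤ ‖ψ‖ :=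
  opNorm_le_bound _ (norm_nonneg ψ) fun a => ψ.le_opNorm ⟨a, h a.2⟩

theorem bidualIncl_apply (Λ : Bidual A) (ψ : Dual B) :
    bidualIncl h Λ ψ = Λ (restrict h ψ) := rfl

/-- The inclusion of biduals carries `zA` to `zB` exactly when restriction intertwines the
corresponding projections of the duals. -/
theorem bidualIncl_eq_iff :
    bidualIncl h zA = zB ↔ ∀ ψ : Dual B, act zA (restrict h ψ) = restrict h (act zB ψ) := by
  constructor
  · rintro rfl ψ
    ext a
    rfl
  · intro H
    ext ψ
    rw [bidualIncl_apply, ← act_apply_one, H, ← act_apply_one zB]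
    rfl

theorem areCompatible_iff (hzA : IsLebesgueProjection e A zA) (hzB : IsLebesgueProjection e B zB)
    (hA : AdmitsLebesgueDecomposition e A) (hB : AdmitsLebesgueDecomposition e B) :
    AreCompatible e h ↔ ∀ ψ : Dual B, act zA (restrict h ψ) = restrict h (act zB ψ) := by
  obtain ⟨L, hL⟩ := hA
  obtain ⟨M, hM⟩ := hB
  constructor
  · intro H ψ
    have hs : ψ - act zB ψ ∈ SG e B := by
      rw [mem_SG_iff hzB hM, map_sub, hzB.act_eq_self (hzB.act_mem ψ), sub_self]
    have h1 := (H ψ (act zB ψ) (ψ - act zB ψ) (by abel) (hzB.act_mem ψ) hs).2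
    rw [mem_SG_iff hzA hL, map_sub, map_sub,
      hzA.act_eq_self (restrict_mem_AC h (hzB.act_mem ψ)), sub_eq_zero] at h1
    exact h1
  · intro H ψ ψa ψs _ ha hs
    refine ⟨restrict_mem_AC h ha, ?_⟩
    rw [mem_SG_iff hzB hM] at hs
    rw [mem_SG_iff hzA hL, H, hs, map_zero]

theorem hasGleasonWhitney_of_restrict_act (hzA : IsLebesgueProjection e A zA)
    (hzB : IsLebesgueProjection e B zB) (hB : AdmitsLebesgueDecomposition e B)
    (H : ∀ ψ : Dual B, act zA (restrict h ψ) = restrict h (act zB ψ)) :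
    HasGleasonWhitney e h := by
  obtain ⟨M, hM⟩ := hB
  rintro φ hφ ψ hψ hn
  have h1 : restrict h (act zB ψ) = φ := by
    rw [← H, hψ, hzA.act_eq_self hφ]
  have h2 := norm_restrict_le h (act zB ψ)
  rw [h1] at h2
  have h3 := hM.norm_eq ψ
  rw [← hzB.act_eq hM] at h3
  have h4 : ‖ψ - act zB ψ‖ ≤ 0 := by linarith
  have h5 : ψ - act zB ψ = 0 := (opNorm_zero_iff _).1 (le_antisymm h4 (norm_nonneg _))
  rw [sub_eq_zero.1 h5]
  exact hzB.act_mem ψ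

/-- In each representation of `W`, the projection given by `zB` is always below that given by
`zA`; under the Gleason-Whitney property a vector fixed by the latter is fixed by the former, as
its vector functional on `B` is a norm-preserving extension of that on `A`. -/
theorem HasGleasonWhitney.bidualIncl_eq (hGW : HasGleasonWhitney e h)
    (hzA : IsLebesgueProjection e A zA) (hzB : IsLebesgueProjection e B zB)
    (hA : AdmitsLebesgueDecomposition e A) (hB : AdmitsLebesgueDecomposition e B) :
    bidualIncl h zA = zB := by
  obtain ⟨L, hL⟩ := hA
  obtain ⟨M, hM⟩ := hB
  ext ψ
  refine mem_of_vectorFunctional_mem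
    (LinearMap.eqLocus (bidualIncl h zA : Dual B →ₗ[ℂ] ℂ) (zB : Dual B →ₗ[ℂ] ℂ))
    (fun H _ _ _ π ξ => ?_) ψ
  rw [LinearMap.mem_eqLocus]
  change zA (vectorFunctional A π ξ ξ) = zB (vectorFunctional B π ξ ξ)
  rw [← inner_extension, ← inner_extension]
  congr 1
  have sA : adjoint (extension π zA) = extension π zA := by
    rw [hzA.eq hL.isLebesgueProjection_dualUnit]
    exact hL.isLProjection.isSelfAdjoint_extension_dualUnit π
  have sB : adjoint (extension π zB) = extension π zB := by
    rw [hzB.eq hM.isLebesgueProjection_dualUnit]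
    exact hM.isLProjection.isSelfAdjoint_extension_dualUnit π
  have iA : ∀ ζ, extension π zA (extension π zA ζ) = extension π zA ζ := by
    rw [hzA.eq hL.isLebesgueProjection_dualUnit]
    exact hL.isLProjection.extension_dualUnit_idem π
  have hBA : ∀ ζ, extension π zA (extension π zB ζ) = extension π zB ζ := fun ζ => by
    refine ext_inner_left ℂ fun η => ?_
    have h1 := restrict_mem_AC h (hzB.act_mem (vectorFunctional B π ζ η))
    rw [act_vectorFunctional, restrict_vectorFunctional] at h1
    rw [inner_extension, ← act_apply_one, hzA.act_eq_self h1, vectorFunctional_one]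
  have hAB : ∀ ζ, extension π zB (extension π zA ζ) = extension π zA ζ := fun ζ => by
    set ξ := extension π zA ζ with hξ
    have h1 : vectorFunctional A π ξ ξ ∈ AC e A := by
      rw [hzA.mem_AC_iff, act_vectorFunctional, hξ, iA]
    have h2 : vectorFunctional B π ξ ξ ∈ AC e B :=
      hGW _ h1 _ (restrict_vectorFunctional π h ξ ξ)
        ((norm_vectorFunctional_self π ξ).trans (norm_vectorFunctional_self π ξ).symm)
    have h3 := hM.isLProjection.norm_sq_extension_dualUnit_le π ξ
    rw [← hzB.eq hM.isLebesgueProjection_dualUnit] at h3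
    refine apply_eq_self_of_inner_eq h3 ?_
    rw [inner_extension, ← act_apply_one, hzB.act_eq_self h2, vectorFunctional_one]
  refine ext_inner_left ℂ fun η => ?_
  rw [← hAB, ← adjoint_inner_left, sB, ← adjoint_inner_left, sA, hBA, ← adjoint_inner_right, sB]

end Inclusion

end Lebesgue

end GleasonWhitney

end

theorem theoremT {W : Type*} [CStarAlgebra W]
    {P : Type*} [NormedAddCommGroup P] [NormedSpace ℂ P] [CompleteSpace P]
    (e : W ≃ₗᵢ[ℂ] StrongDual ℂ P) (A B : Subalgebra ℂ W) (h : A ≤ B)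
    (hA : GleasonWhitney.AdmitsLebesgueDecomposition e A)
    (hB : GleasonWhitney.AdmitsLebesgueDecomposition e B) :
    (∃! z : GleasonWhitney.Bidual A, GleasonWhitney.IsLebesgueProjection e A z) ∧
    (∃! z : GleasonWhitney.Bidual B, GleasonWhitney.IsLebesgueProjection e B z) ∧
    ∀ (zA : GleasonWhitney.Bidual A) (zB : GleasonWhitney.Bidual B),
      GleasonWhitney.IsLebesgueProjection e A zA → GleasonWhitney.IsLebesgueProjection e B zB →
      List.TFAE [
        GleasonWhitney.HasGleasonWhitney e h,
        GleasonWhitney.bidualIncl h zA = zB,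
        GleasonWhitney.AreCompatible e h] := by
  refine ⟨GleasonWhitney.existsUnique_isLebesgueProjection hA,
    GleasonWhitney.existsUnique_isLebesgueProjection hB, fun zA zB hzA hzB => ?_⟩
  tfae_have 1 → 2 := fun hGW => hGW.bidualIncl_eq h hzA hzB hA hB
  tfae_have 2 → 3 := fun H => (GleasonWhitney.areCompatible_iff h hzA hzB hA hB).2
    ((GleasonWhitney.bidualIncl_eq_iff h).1 H)
  tfae_have 3 → 1 := fun H => GleasonWhitney.hasGleasonWhitney_of_restrict_act h hzA hzB hB
    ((GleasonWhitney.areCompatible_iff h hzA hzB hA hB).1 H)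
  tfae_finish
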